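/- Let $I$ be a finite set of students and $S$ a finite set of schools with $|I|>|S|\ge 3$. A problem $(P,\succ,q)$ consists of a strict preference order $P_i$ of each student $i$ over $S\cup\{\emptyset\}$, where $\emptyset$ is being unmatched (a school $s$ is acceptable to $i$ if $s\mathrel{P_i}\emptyset$), a strict priority order $\succ_s$ of each school $s$ over $I$, and a capacity $q_s\in\{0,1,2,\dots\}$ of each school $s$. A matching is a map $\mu:I\to S\cup\{\emptyset\}$ with $|\mu^{-1}(s)|\le q_s$ for all $s\in S$. It is stable at $(P,\succ,q)$ if no student prefers $\emptyset$ to $\mu(i)$ and there is no pair $(i,s)\in I\times S$ such that $s\mathrel{P_i}\mu(i)$ and either $|\mu^{-1}(s)|<q_s$ or $i\succ_s j$ for some $j$ with $\mu(j)=s$. Let $GS(P,\succ,q)$ be the outcome of the student-proposing deferred acceptance algorithm of Gale and Shapley, and let $GS^k(P,\succ,q)=GS(P^k,\succ,q)$, where $P^k_i$ orders the schools as $P_i$ does, but only the $k$ most preferred acceptable schools under $P_i$ (all acceptable schools, if there are fewer than $k$) are acceptable under $P^k_i$. Theorem. Let $|S|\ge k>\ell\ge 1$. Then $GS^k$ is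 more fair by stability than $GS^\ell$, that is: (i) for every problem $(P,\succ,q)$ such that $GS^\ell(P,\succ,q)$ is stable at $(P,\succ,q)$, the matching $GS^k(P,\succ,q)$ is stable at $(P,\succ,q)$; (ii) there is a problem $(P,\succ,q)$ such that $GS^k(P,\succ,q)$ is stable at $(P,\succ,q)$ but $GS^\ell(P,\succ,q)$ is not. Moreover, the problem in (ii) can be chosen with $q_s\ge 1$ for every school $s$. -/

import Mathlib

namespace SchoolChoice

/-- A school choice problem with students `I` and schools `S`. The outside option is `none`. -/
structure Problem (I S : Type*) where
  /-- `pref i a b`: student `i` strictly prefers `a` to `b`. -/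
  pref : I → Option S → Option S → Prop
  pref_strict : ∀ i, IsStrictTotalOrder (Option S) (pref i)
  /-- `prio s i j`: student `i` has higher priority than student `j` at school `s`. -/
  prio : S → I → I → Prop
  prio_strict : ∀ s, IsStrictTotalOrder I (prio s)
  /-- The number of available seats. -/
  cap : S → ℕ

/-- A matching for the capacity vector `q`. -/
structure Matching (I : Type*) {S : Type*} (q : S → ℕ) where
  toFun : I → Option S
  encard_le : ∀ s, {i | toFun i = some s}.encard ≤ q s

section Stability

variable {I S : Type*}

/-- School `s` is acceptable to student `i`. -/
def Problem.Acceptable (p : Problem I S) (i : I) (s : S) : Prop := p.pref i (some s) none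

/-- `μ` assigns to every student an outcome that she finds at least as good as being unmatched. -/
def IndividuallyRational (p : Problem I S) {q : S → ℕ} (μ : Matching I q) : Prop :=
  ∀ i, p.pref i (μ.toFun i) none ∨ μ.toFun i = none

/-- The pair `(i, s)` blocks `μ` at the problem `p`. -/
def Blocks (p : Problem I S) (μ : Matching I p.cap) (i : I) (s : S) : Prop :=
  p.pref i (some s) (μ.toFun i) ∧
    ((∃ j, μ.toFun j = some s ∧ p.prio s i j) ∨
      {j | μ.toFun j = some s}.encard < p.cap s)

/-- Student `i` is a blocking student for `μ` at the problem `p`. -/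
def IsBlockingStudent (p : Problem I S) (μ : Matching I p.cap) (i : I) : Prop :=
  ∃ s, Blocks p μ i s

/-- `μ` is stable at the problem `p`. -/
def IsStable (p : Problem I S) (μ : Matching I p.cap) : Prop :=
  IndividuallyRational p μ ∧ ∀ i, ¬ IsBlockingStudent p μ i

/-- A mechanism maps each problem to a matching. -/
abbrev Mechanism (I S : Type*) := (p : Problem I S) → Matching I p.cap

/-- The mechanism `φ'` is more fair by stability than the mechanism `φ`. -/
def MoreFairByStability (φ' φ : Mechanism I S) : Prop :=
  (∀ p : Problem I S, IsStable p (φ p) → IsStable p (φ' p)) ∧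
    ∃ p : Problem I S, IsStable p (φ' p) ∧ ¬ IsStable p (φ p)

end Stability

section GaleShapley

variable {I S : Type*}

/-- During the algorithm `R i` is the set of the schools that have already rejected student `i`.
`Applies p R i s` says that `s` is her most preferred acceptable school among those that have not
rejected her. A student who is tentatively accepted by `s` has not been rejected by `s`, so at each
step the students who stand at `s` are those tentatively accepted by `s` at the previous step
together with the new applicants of `s`. -/
def Applies (p : Problem I S) (R : I → Set S) (i : I) (s : S) : Prop :=
  p.Acceptable i s ∧ s ∉ R i ∧
    ∀ s', p.Acceptable i s' → s' ∉ R i → s' ≠ s → p.pref i (some s) (some s')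

/-- School `s` rejects its applicant `i`: at least `q_s` of its current applicants have a higher
priority than `i`, so that `i` is not among the `min(q_s, number of applicants)` applicants of
highest priority. -/
def Rejects (p : Problem I S) (R : I → Set S) (s : S) (i : I) : Prop :=
  Applies p R i s ∧ (p.cap s : ℕ∞) ≤ {j | Applies p R j s ∧ p.prio s j i}.encard

/-- One step of the student-proposing deferred acceptance algorithm. -/
def step (p : Problem I S) (R : I → Set S) : I → Set S :=
  fun i => R i ∪ {s | Rejects p R s i}

/-- The rejections made during the first `t` steps. -/
def rejections (p : Problem I S) (t : ℕ) : I → Set S := (step p)^[t] (fun _ => ∅)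

theorem rejections_succ (p : Problem I S) (t : ℕ) :
    rejections p (t + 1) = step p (rejections p t) :=
  Function.iterate_succ_apply' _ _ _

theorem exists_no_rejection [Finite I] [Finite S] (p : Problem I S) :
    ∃ t, rejections p (t + 1) = rejections p t := by
  have hm : Monotone (rejections p) := monotone_nat_of_le_succ fun t => by
    rw [rejections_succ]
    exact fun i => Set.subset_union_left
  obtain ⟨n, hn⟩ := WellFoundedGT.monotone_chain_condition ⟨rejections p, hm⟩
  exact ⟨n, (hn (n + 1) (Nat.le_succ n)).symm⟩

open Classical in
/-- The rejections made until the algorithm stops, that is, until the first step in which no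
student is rejected. -/
noncomputable def finalRejections [Finite I] [Finite S] (p : Problem I S) : I → Set S :=
  rejections p (Nat.find (exists_no_rejection p))

theorem step_finalRejections [Finite I] [Finite S] (p : Problem I S) :
    step p (finalRejections p) = finalRejections p := by
  classical
  rw [finalRejections, ← rejections_succ]
  exact Nat.find_spec (exists_no_rejection p)

open Classical in
/-- The school at which student `i` stands when the algorithm stops, if any. -/
noncomputable def outcome [Finite I] [Finite S] (p : Problem I S) (i : I) : Option S :=
  if h : ∃ s, Applies p (finalRejections p) i s then some h.choose else none

theorem applies_of_outcome [Finite I] [Finite S] (p : Problem I S) {i : I} {s : S}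
    (h : outcome p i = some s) : Applies p (finalRejections p) i s := by
  unfold outcome at h
  split_ifs at h with h'
  rw [← Option.some.inj h]
  exact h'.choose_spec

theorem outcome_encard_le [Finite I] [Finite S] (p : Problem I S) (s : S) :
    {i | outcome p i = some s}.encard ≤ p.cap s := by
  set A : Set I := {i | Applies p (finalRejections p) i s} with hA
  refine (Set.encard_le_encard (t := A) fun i hi => applies_of_outcome p hi).trans ?_
  rcases A.eq_empty_or_nonempty with h0 | hne
  · simp [h0]
  have := p.prio_strict s
  -- the applicant with the lowest priority
  obtain ⟨i, hi, hmin⟩ :=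
    (Finite.wellFounded_of_trans_of_irrefl (Function.swap (p.prio s))).has_min A hne
  have hnot : ¬ Rejects p (finalRejections p) s i := fun hr => by
    have : s ∈ finalRejections p i := by
      rw [← step_finalRejections]
      exact Or.inr hr
    exact hi.2.1 this
  have hlt : {j | Applies p (finalRejections p) j s ∧ p.prio s j i}.encard < p.cap s := by
    by_contra hge
    exact hnot ⟨hi, not_lt.mp hge⟩
  have hsub : A ⊆ insert i {j | Applies p (finalRejections p) j s ∧ p.prio s j i} := by
    intro j hj
    rcases trichotomous_of (p.prio s) j i with h | h | h
    · exact Or.inr ⟨hj, h⟩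
    · exact Or.inl h
    · exact absurd h (hmin j hj)
  calc A.encard ≤ _ := Set.encard_le_encard hsub
    _ ≤ _ := Set.encard_insert_le _ _
    _ ≤ p.cap s := Order.add_one_le_of_lt hlt

/-- The Gale-Shapley mechanism. -/
noncomputable def GS [Finite I] [Finite S] : Mechanism I S :=
  fun p => ⟨outcome p, outcome_encard_le p⟩

end GaleShapley

section Constraint

variable {I S : Type*}

/-- School `s` is one of the `k` most preferred acceptable schools of student `i`. -/
def Problem.IsTop (p : Problem I S) (k : ℕ) (i : I) (s : S) : Prop :=
  p.Acceptable i s ∧ {s' | p.Acceptable i s' ∧ p.pref i (some s') (some s)}.encard < k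

/-- The truncation of the preference relation of student `i` after her `k`-th acceptable school:
the schools are ordered as before, and exactly her `k` most preferred acceptable schools (all of
them if there are fewer) remain acceptable. -/
def Problem.truncPref (p : Problem I S) (k : ℕ) (i : I) : Option S → Option S → Prop
  | some s, some s' => p.pref i (some s) (some s')
  | some s, none => p.IsTop k i s
  | none, some s => ¬ p.IsTop k i s
  | none, none => False

theorem Problem.IsTop.of_pref {p : Problem I S} {k : ℕ} {i : I} {s s' : S}
    (h : p.IsTop k i s') (hs : p.pref i (some s) (some s')) : p.IsTop k i s := by
  have := p.pref_strict i
  refine ⟨_root_.trans (r := p.pref i) hs h.1, lt_of_le_of_lt (Set.encard_le_encard ?_) h.2⟩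
  exact fun a ha => ⟨ha.1, _root_.trans (r := p.pref i) ha.2 hs⟩

theorem Problem.truncPref_strict (p : Problem I S) (k : ℕ) (i : I) :
    IsStrictTotalOrder (Option S) (p.truncPref k i) := by
  have := p.pref_strict i
  refine { trichotomous := ?_, irrefl := ?_, trans := ?_ }
  · rintro (_ | a) (_ | b) h1 h2
    · rfl
    · exact (h2 (by_contra h1)).elim
    · exact (h1 (by_contra h2)).elim
    · rcases trichotomous_of (p.pref i) (some a) (some b) with h | h | h
      · exact (h1 h).elim
      · exact h
      · exact (h2 h).elim
  · rintro (_ | a) h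
    · exact h
    · exact _root_.irrefl (r := p.pref i) _ h
  · rintro (_ | a) (_ | b) (_ | c) h1 h2
    · exact h1
    · exact h2
    · exact h1 h2
    · exact fun h => h1 (h.of_pref h2)
    · exact h1
    · rcases trichotomous_of (p.pref i) (some a) (some c) with h | h | h
      · exact h
      · exact (h2 (Option.some.inj h ▸ h1)).elim
      · exact (h2 (Problem.IsTop.of_pref h1 h)).elim
    · exact Problem.IsTop.of_pref h2 h1
    · exact _root_.trans (r := p.pref i) h1 h2

/-- The problem in which every student's preference relation is truncated after her `k`-th
acceptable school. -/
def Problem.truncate (p : Problem I S) (k : ℕ) : Problem I S where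
  pref := p.truncPref k
  pref_strict := p.truncPref_strict k
  prio := p.prio
  prio_strict := p.prio_strict
  cap := p.cap

/-- The constrained version of a mechanism. -/
def Mechanism.constrained (φ : Mechanism I S) (k : ℕ) : Mechanism I S :=
  fun p => φ (p.truncate k)

end Constraint

end SchoolChoice

/-!
The key point is that if `GS^ℓ` is stable at the true preferences, then `GS^k` selects the very same
matching.

Write `μ` for the outcome of `GS^ℓ`. Lengthening the preference lists only adds rejections
(`finalRejections_truncate_subset`), because a school that has rejected a student keeps at least
`q_s` applicants of higher priority from then on (`le_encard_applicants_of_mem_rejections`). On the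
other hand `μ`, being stable at `P`, is also stable at `P^k` (`IsStable.truncate`), and no student is
ever rejected by her partner in a stable matching (`notMem_rejections_of_isStable`). Hence every
student matched under `μ` keeps her school under `GS^k`. A student unmatched under `μ` cannot gain a
seat: it would be at a school that, by stability of `μ`, is already filled under `μ`, and whose
students all stay there.

For strictness, let all students share one ranking in which exactly `k` schools are acceptable, and
let every school have one seat. Truncation at `k` changes nothing, so `GS^k` is stable
(`isStable_GS`). Under `GS^ℓ` the school ranked just below the first `ℓ` is empty, while some
student is unmatched because there are more students than seats; the two block.
-/

namespace SchoolChoice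

variable {I S : Type*}

theorem mem_of_encard_le {A B : Set I} {q : ℕ} (hA : (q : ℕ∞) ≤ A.encard) (hB : B.encard ≤ q)
    (hAB : A ⊆ B) {i : I} (hi : i ∈ B) : i ∈ A := by
  by_contra hnot
  have h1 := (Set.encard_le_encard (Set.insert_subset hi hAB)).trans hB
  rw [Set.encard_insert_of_notMem hnot] at h1
  have h2 := (add_le_add_left hA 1).trans h1
  norm_cast at h2
  omega

/-! ### Rejections in the deferred acceptance algorithm -/

theorem mem_step {p : Problem I S} {R : I → Set S} {i : I} {s : S} :
    s ∈ step p R i ↔ s ∈ R i ∨ Rejects p R s i := Iff.rfl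

theorem Applies.unique {p : Problem I S} {R : I → Set S} {i : I} {s s' : S}
    (h : Applies p R i s) (h' : Applies p R i s') : s = s' := by
  have := p.pref_strict i
  by_contra hne
  exact asymm_of (p.pref i) (h.2.2 s' h'.1 h'.2.1 (Ne.symm hne)) (h'.2.2 s h.1 h.2.1 hne)

theorem Applies.step_of_not_rejects {p : Problem I S} {R : I → Set S} {i : I} {s : S}
    (h : Applies p R i s) (hr : ¬ Rejects p R s i) : Applies p (step p R) i s :=
  ⟨h.1, fun hs => (mem_step.mp hs).elim h.2.1 hr,
    fun s' ha hs' hne => h.2.2 s' ha (fun hs => hs' (Or.inl hs)) hne⟩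

/-- The applicants with higher priority than `i` at a school do not drop below the capacity
in a step: a school rejects only applicants that are outranked by `q_s` others. -/
theorem le_encard_applicants_step [Finite I] {p : Problem I S} {R : I → Set S} {i : I} {s : S}
    (h : (p.cap s : ℕ∞) ≤ {j | Applies p R j s ∧ p.prio s j i}.encard) :
    (p.cap s : ℕ∞) ≤ {j | Applies p (step p R) j s ∧ p.prio s j i}.encard := by
  have := p.prio_strict s
  rcases Set.eq_empty_or_nonempty {j | Rejects p R s j ∧ p.prio s j i} with h0 | hne
  · refine h.trans (Set.encard_le_encard fun j hj => ⟨hj.1.step_of_not_rejects fun hr => ?_, hj.2⟩)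
    exact (Set.eq_empty_iff_forall_notMem.mp h0 j) ⟨hr, hj.2⟩
  · -- the rejected student of highest priority; the `q_s` applicants above her all stay
    obtain ⟨a, ha, hmax⟩ :=
      (Finite.wellFounded_of_trans_of_irrefl (p.prio s)).has_min _ hne
    refine ha.1.2.trans (Set.encard_le_encard fun j hj => ?_)
    have hji : p.prio s j i := _root_.trans (r := p.prio s) hj.2 ha.2
    exact ⟨hj.1.step_of_not_rejects fun hr => hmax j ⟨hr, hji⟩ hj.2, hji⟩

/-- A school that has rejected `i` holds at least `q_s` applicants of higher priority than `i`
from then on. -/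
theorem le_encard_applicants_of_mem_rejections [Finite I] {p : Problem I S} {i : I} {s : S} :
    ∀ t, s ∈ rejections p t i →
      (p.cap s : ℕ∞) ≤ {j | Applies p (rejections p t) j s ∧ p.prio s j i}.encard
  | 0, h => h.elim
  | t + 1, h => by
    rw [rejections_succ] at h ⊢
    apply le_encard_applicants_step
    rcases mem_step.mp h with h | h
    · exact le_encard_applicants_of_mem_rejections t h
    · exact h.2

/-- A student is never rejected by her partner in a stable matching. -/
theorem notMem_rejections_of_isStable [Finite I] {p : Problem I S} {μ : Matching I p.cap}
    (hμ : IsStable p μ) : ∀ (t : ℕ) {i : I} {s : S}, μ.toFun i = some s → s ∉ rejections p t i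
  | 0, _, _, _ => fun h => h
  | t + 1, i, s, his => by
    rw [rejections_succ, mem_step, not_or]
    refine ⟨notMem_rejections_of_isStable hμ t his, fun hr => ?_⟩
    have := p.prio_strict s
    by_cases hsub : {j | Applies p (rejections p t) j s ∧ p.prio s j i} ⊆ {j | μ.toFun j = some s}
    · -- then `s` would be assigned `i` in addition to `q_s` other students
      exact _root_.irrefl (r := p.prio s) i (mem_of_encard_le hr.2 (μ.encard_le s) hsub his).2
    · -- an applicant above `i` who is not assigned to `s` blocks with `s`
      obtain ⟨j, hj, hjs⟩ := Set.not_subset.mp hsub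
      refine hμ.2 j ⟨s, ?_, Or.inl ⟨i, his, hj.2⟩⟩
      cases hm : μ.toFun j with
      | none => exact hj.1.1
      | some s' =>
        have hacc : p.Acceptable j s' := by
          rcases hμ.1 j with h | h
          · rwa [hm] at h
          · simp [hm] at h
        exact hj.1.2.2 s' hacc (notMem_rejections_of_isStable hμ t hm) fun he => hjs (he ▸ hm)

/-! ### Stability of the Gale-Shapley outcome -/

theorem exists_applies [Finite S] {p : Problem I S} {R : I → Set S} {i : I} {s : S}
    (ha : p.Acceptable i s) (hs : s ∉ R i) :
    ∃ s', Applies p R i s' ∧ (s' = s ∨ p.pref i (some s') (some s)) := by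
  have := p.pref_strict i
  have hwf := InvImage.wf some (Finite.wellFounded_of_trans_of_irrefl (p.pref i))
  obtain ⟨m, hm, hmin⟩ := hwf.has_min {s' | p.Acceptable i s' ∧ s' ∉ R i} ⟨s, ha, hs⟩
  have hbest : ∀ s', p.Acceptable i s' → s' ∉ R i → s' ≠ m → p.pref i (some m) (some s') := by
    intro s' ha' hs' hne
    rcases trichotomous_of (p.pref i) (some m) (some s') with h | h | h
    · exact h
    · exact (hne (Option.some.inj h).symm).elim
    · exact (hmin s' ⟨ha', hs'⟩ h).elim
  refine ⟨m, ⟨hm.1, hm.2, hbest⟩, ?_⟩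
  rcases eq_or_ne s m with h | h
  · exact Or.inl h.symm
  · exact Or.inr (hbest s ha hs h)

section Outcome

variable [Finite I] [Finite S]

theorem outcome_eq_some_iff {p : Problem I S} {i : I} {s : S} :
    outcome p i = some s ↔ Applies p (finalRejections p) i s := by
  refine ⟨applies_of_outcome p, fun h => ?_⟩
  have hex : ∃ s, Applies p (finalRejections p) i s := ⟨s, h⟩
  rw [outcome, dif_pos hex, hex.choose_spec.unique h]

/-- Every school that a student prefers to her outcome has rejected her. -/
theorem mem_finalRejections_of_pref_outcome {p : Problem I S} {i : I} {s : S}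
    (ha : p.Acceptable i s) (h : p.pref i (some s) (outcome p i)) : s ∈ finalRejections p i := by
  have := p.pref_strict i
  by_contra hs
  obtain ⟨s', hs', h'⟩ := exists_applies ha hs
  rw [outcome_eq_some_iff.mpr hs'] at h
  rcases h' with rfl | h'
  · exact _root_.irrefl (r := p.pref i) _ h
  · exact asymm_of (p.pref i) h h'

theorem le_encard_outcome_of_mem_finalRejections {p : Problem I S} {i : I} {s : S}
    (h : s ∈ finalRejections p i) :
    (p.cap s : ℕ∞) ≤ {j | outcome p j = some s ∧ p.prio s j i}.encard := by
  simp only [outcome_eq_some_iff]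
  exact le_encard_applicants_of_mem_rejections _ h

theorem isStable_GS (p : Problem I S) : IsStable p (GS p) := by
  refine ⟨fun i => ?_, ?_⟩
  · change p.pref i (outcome p i) none ∨ outcome p i = none
    cases h : outcome p i with
    | none => exact Or.inr rfl
    | some s => exact Or.inl (applies_of_outcome p h).1
  · rintro i ⟨s, hpref, hblock⟩
    have := p.pref_strict i
    have := p.prio_strict s
    change p.pref i (some s) (outcome p i) at hpref
    have ha : p.Acceptable i s := by
      cases h : outcome p i with
      | none => rwa [h] at hpref
      | some s' =>
        rw [h] at hpref
        exact _root_.trans (r := p.pref i) hpref (applies_of_outcome p h).1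
    have hle :=
      le_encard_outcome_of_mem_finalRejections (mem_finalRejections_of_pref_outcome ha hpref)
    rcases hblock with ⟨j, hj, hij⟩ | hlt
    · have hji := (mem_of_encard_le hle (outcome_encard_le p s) (fun a ha => ha.1) hj).2
      exact asymm_of (p.prio s) hji hij
    · have hsub : {j | outcome p j = some s ∧ p.prio s j i} ⊆ {j | outcome p j = some s} :=
        fun a ha => ha.1
      exact absurd (hle.trans (Set.encard_le_encard hsub)) (not_le.mpr hlt)

end Outcome

/-! ### Truncated preferences -/

theorem Problem.IsTop.mono {p : Problem I S} {k l : ℕ} (hlk : l ≤ k) {i : I} {s : S}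
    (h : p.IsTop l i s) : p.IsTop k i s :=
  ⟨h.1, h.2.trans_le (by exact_mod_cast hlk)⟩

theorem acceptable_truncate {p : Problem I S} {k : ℕ} {i : I} {s : S} :
    (p.truncate k).Acceptable i s ↔ p.IsTop k i s := Iff.rfl

/-- A student who applies to `s` under the shorter list also does so under the longer one after
further rejections, unless `s` itself has rejected her: her additional schools are all worse. -/
theorem Applies.truncate_mono {p : Problem I S} {k l : ℕ} (hlk : l ≤ k) {R R' : I → Set S}
    {i : I} {s : S} (h : Applies (p.truncate l) R i s) (hR : R i ⊆ R' i) (hs : s ∉ R' i) :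
    Applies (p.truncate k) R' i s := by
  have := p.pref_strict i
  refine ⟨Problem.IsTop.mono hlk h.1, hs, fun s' _ hs' hne => ?_⟩
  change p.pref i (some s) (some s')
  rcases trichotomous_of (p.pref i) (some s) (some s') with h' | h' | h'
  · exact h'
  · exact (hne (Option.some.inj h').symm).elim
  · exact h.2.2 s' (Problem.IsTop.of_pref h.1 h') (fun hm => hs' (hR hm)) hne

theorem finalRejections_truncate_subset [Finite I] [Finite S] (p : Problem I S) {k l : ℕ}
    (hlk : l ≤ k) (i : I) :
    finalRejections (p.truncate l) i ⊆ finalRejections (p.truncate k) i := by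
  suffices h : ∀ t i, rejections (p.truncate l) t i ⊆ finalRejections (p.truncate k) i from h _ i
  intro t
  induction t with
  | zero => exact fun i => Set.empty_subset _
  | succ t ih =>
    intro i s hs
    rw [rejections_succ] at hs
    rcases mem_step.mp hs with hs | hs
    · exact ih i hs
    by_contra hns
    have := p.prio_strict s
    have happ := hs.1.truncate_mono hlk (ih i) hns
    refine hns ?_
    rw [← step_finalRejections]
    refine Or.inr ⟨happ, ?_⟩
    by_cases hall : ∀ j, Applies (p.truncate l) (rejections (p.truncate l) t) j s →
        p.prio s j i → s ∉ finalRejections (p.truncate k) j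
    · exact hs.2.trans (Set.encard_le_encard fun j hj =>
        ⟨hj.1.truncate_mono hlk (ih j) (hall j hj.1 hj.2), hj.2⟩)
    · push Not at hall
      obtain ⟨j, -, hji, hj⟩ := hall
      refine (le_encard_applicants_of_mem_rejections _ hj).trans
        (Set.encard_le_encard fun a ha => ⟨ha.1, ?_⟩)
      exact _root_.trans (r := p.prio s) ha.2 hji

/-- A stable matching stays stable after a truncation of the preferences that keeps all assigned
schools acceptable. -/
theorem IsStable.truncate {p : Problem I S} {k : ℕ} {μ : Matching I p.cap} (hμ : IsStable p μ)
    (htop : ∀ i s, μ.toFun i = some s → p.IsTop k i s) : IsStable (p.truncate k) μ := by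
  refine ⟨fun i => ?_, ?_⟩
  · cases h : μ.toFun i with
    | none => exact Or.inr rfl
    | some s => exact Or.inl (htop i s h)
  · rintro i ⟨s, hpref, hblock⟩
    refine hμ.2 i ⟨s, ?_, hblock⟩
    cases h : μ.toFun i with
    | none => rw [h] at hpref; exact hpref.1
    | some s' => rw [h] at hpref; exact hpref

/-- Truncation after the `k`-th school has no effect if nobody has more than `k` acceptable
schools. -/
theorem truncate_pref_eq {p : Problem I S} {k : ℕ}
    (h : ∀ i s, p.Acceptable i s → p.IsTop k i s) : (p.truncate k).pref = p.pref := by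
  funext i a b
  have := p.pref_strict i
  apply propext
  rcases a with _ | a <;> rcases b with _ | b
  · exact ⟨False.elim, _root_.irrefl (r := p.pref i) none⟩
  · change ¬ p.IsTop k i b ↔ _
    refine ⟨fun hb => ?_, fun hb ht => asymm_of (p.pref i) hb ht.1⟩
    rcases trichotomous_of (p.pref i) none (some b) with h' | h' | h'
    · exact h'
    · cases h'
    · exact (hb (h i b h')).elim
  · exact ⟨fun ht => ht.1, h i a⟩
  · exact Iff.rfl

/-- If the outcome under the shorter lists is stable at the true preferences, then lengthening the
lists does not change it. -/
theorem outcome_truncate_eq_of_isStable [Finite I] [Finite S] {p : Problem I S} {k l : ℕ}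
    (hlk : l ≤ k) (hst : IsStable p ((GS (I := I) (S := S)).constrained l p)) (i : I) :
    outcome (p.truncate k) i = outcome (p.truncate l) i := by
  have hstk : IsStable (p.truncate k) ((GS (I := I) (S := S)).constrained l p) :=
    hst.truncate fun i s h => Problem.IsTop.mono hlk (applies_of_outcome (p.truncate l) h).1
  have hkeep : ∀ i s, outcome (p.truncate l) i = some s → outcome (p.truncate k) i = some s :=
    fun i s h => outcome_eq_some_iff.mpr <|
      (applies_of_outcome _ h).truncate_mono hlk (finalRejections_truncate_subset p hlk i)
        (notMem_rejections_of_isStable hstk _ h)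
  cases h : outcome (p.truncate l) i with
  | some s => exact hkeep i s h
  | none =>
    cases h' : outcome (p.truncate k) i with
    | none => rfl
    | some s =>
      -- the pair `(i, s)` does not block the first matching, so `s` is full there already
      exfalso
      have hfull : ¬ {j | outcome (p.truncate l) j = some s}.encard < p.cap s := fun hlt =>
        hstk.2 i ⟨s, by
          change (p.truncate k).pref i (some s) (outcome (p.truncate l) i)
          rw [h]
          exact (applies_of_outcome _ h').1, Or.inr hlt⟩
      have hi : outcome (p.truncate l) i = some s :=
        mem_of_encard_le (not_lt.mp hfull) (outcome_encard_le (p.truncate k) s)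
          (fun j hj => hkeep j s hj) h'
      rw [h] at hi
      cases hi

theorem isStable_constrained_of_le [Finite I] [Finite S] {p : Problem I S} {k l : ℕ}
    (hlk : l ≤ k) (hst : IsStable p ((GS (I := I) (S := S)).constrained l p)) :
    IsStable p ((GS (I := I) (S := S)).constrained k p) := by
  have heq : (GS (I := I) (S := S)).constrained k p = (GS (I := I) (S := S)).constrained l p :=
    congrArg (fun f : {f : I → Option S // ∀ s, {i | f i = some s}.encard ≤ p.cap s} =>
      (⟨f.1, f.2⟩ : Matching I p.cap))
      (a₁ := ⟨_, outcome_encard_le (p.truncate k)⟩) (a₂ := ⟨_, outcome_encard_le (p.truncate l)⟩)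
      (Subtype.ext (funext (outcome_truncate_eq_of_isStable hlk hst)))
  rwa [heq]

/-! ### A problem with a common ranking of the schools -/

theorem isStrictTotalOrder_of_injective {α : Type*} {f : α → ℕ} (hf : Function.Injective f) :
    IsStrictTotalOrder α fun a b => f a < f b where
  trichotomous a b h1 h2 := hf (by omega)
  irrefl a := lt_irrefl (f a)
  trans a b c := lt_trans

/-- The position of an outcome in the ranking that lists the schools in the order of `e`, with the
outside option placed right after the first `k` schools. Schools get odd positions and the outside
option an even one. -/
def commonRank {m : ℕ} (e : S ≃ Fin m) (k : ℕ) : Option S → ℕ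
  | some s => 2 * (e s : ℕ) + 1
  | none => 2 * k

theorem commonRank_injective {m : ℕ} (e : S ≃ Fin m) (k : ℕ) :
    Function.Injective (commonRank e k) := by
  rintro (_ | a) (_ | b) h
  · rfl
  · simp only [commonRank] at h
    omega
  · simp only [commonRank] at h
    omega
  · simp only [commonRank] at h
    exact congrArg some (e.injective (Fin.ext (by omega)))

/-- The problem in which all students rank the outcomes by `commonRank e k`, all schools rank the
students in the order of `g`, and every school has one seat. -/
def commonProblem {m n : ℕ} (e : S ≃ Fin m) (g : I ≃ Fin n) (k : ℕ) : Problem I S where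
  pref _ a b := commonRank e k a < commonRank e k b
  pref_strict _ := isStrictTotalOrder_of_injective (commonRank_injective e k)
  prio _ i j := (g i : ℕ) < g j
  prio_strict _ := isStrictTotalOrder_of_injective (Fin.val_injective.comp g.injective)
  cap _ := 1

theorem acceptable_commonProblem {m n : ℕ} {e : S ≃ Fin m} {g : I ≃ Fin n} {k : ℕ} {i : I}
    {s : S} : (commonProblem e g k).Acceptable i s ↔ (e s : ℕ) < k := by
  simp only [Problem.Acceptable, commonProblem, commonRank]
  omega

theorem encard_setOf_equiv_lt {m : ℕ} (e : S ≃ Fin m) {a : ℕ} (ha : a ≤ m) :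
    {s | (e s : ℕ) < a}.encard = a := by
  have hinj : Function.Injective fun s => (e s : ℕ) := Fin.val_injective.comp e.injective
  have himg : (fun s => (e s : ℕ)) '' {s | (e s : ℕ) < a} = (Finset.range a : Set ℕ) := by
    ext x
    simp only [Set.mem_image, Set.mem_ofPred_eq, Finset.coe_range, Set.mem_Iio]
    constructor
    · rintro ⟨s, hs, rfl⟩
      exact hs
    · exact fun hx => ⟨e.symm ⟨x, by omega⟩, by simpa using hx, by simp⟩
  rw [← hinj.encard_image, himg, Set.encard_coe_eq_coe_finsetCard, Finset.card_range]

theorem isTop_commonProblem {m n : ℕ} {e : S ≃ Fin m} {g : I ≃ Fin n} {k l : ℕ} {i : I} {s : S} :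
    (commonProblem e g k).IsTop l i s ↔ (e s : ℕ) < k ∧ (e s : ℕ) < l := by
  rw [Problem.IsTop, acceptable_commonProblem]
  refine and_congr_right fun hs => ?_
  have hset : {s' | (commonProblem e g k).Acceptable i s' ∧
      (commonProblem e g k).pref i (some s') (some s)} = {s' | (e s' : ℕ) < e s} := by
    ext s'
    simp only [Set.mem_ofPred_eq, acceptable_commonProblem]
    simp only [commonProblem, commonRank]
    omega
  rw [hset, encard_setOf_equiv_lt e (e s).2.le]
  norm_cast

theorem isStable_constrained_commonProblem [Finite I] [Finite S] {m n : ℕ} (e : S ≃ Fin m)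
    (g : I ≃ Fin n) (k : ℕ) :
    IsStable (commonProblem e g k)
      ((GS (I := I) (S := S)).constrained k (commonProblem e g k)) := by
  have hpref : ((commonProblem e g k).truncate k).pref = (commonProblem e g k).pref :=
    truncate_pref_eq fun i s h => by
      rw [acceptable_commonProblem] at h
      exact isTop_commonProblem.mpr ⟨h, h⟩
  have hst := isStable_GS ((commonProblem e g k).truncate k)
  simp only [IsStable, IndividuallyRational, IsBlockingStudent, Blocks, hpref] at hst
  exact hst

theorem not_isStable_constrained_commonProblem [Finite I] [Finite S] {m n : ℕ} (e : S ≃ Fin m)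
    (g : I ≃ Fin n) {k l : ℕ} (hlk : l < k) (hkm : k ≤ m) (hmn : m < n) :
    ¬ IsStable (commonProblem e g k)
      ((GS (I := I) (S := S)).constrained l (commonProblem e g k)) := by
  intro hst
  have hun : ∃ i, outcome ((commonProblem e g k).truncate l) i = none := by
    by_contra! hall
    choose f hf using fun i => Option.ne_none_iff_exists'.mp (hall i)
    have hinj : Function.Injective f := fun i j hij => by
      have hle := outcome_encard_le ((commonProblem e g k).truncate l) (f i)
      exact Set.encard_le_one_iff.mp hle i j (hf i) (hij ▸ hf j)
    have hcard := Fintype.card_le_of_injective (e ∘ f ∘ g.symm)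
      (e.injective.comp (hinj.comp g.symm.injective))
    simp only [Fintype.card_fin] at hcard
    omega
  obtain ⟨i, hi⟩ := hun
  -- the school in position `l` (counted from `0`) is acceptable but on no truncated list
  let s : S := e.symm ⟨l, by omega⟩
  have hs : (e s : ℕ) = l := by simp [s]
  refine hst.2 i ⟨s, ?_, Or.inr ?_⟩
  · change (commonProblem e g k).pref i (some s) (outcome ((commonProblem e g k).truncate l) i)
    rw [hi]
    exact acceptable_commonProblem.mpr (hs ▸ hlk)
  · change {j | outcome ((commonProblem e g k).truncate l) j = some s}.encard < ((1 : ℕ) : ℕ∞)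
    have hempty : {j | outcome ((commonProblem e g k).truncate l) j = some s} = ∅ :=
      Set.eq_empty_iff_forall_notMem.mpr fun j hj => by
        have htop := isTop_commonProblem.mp (acceptable_truncate.mp (applies_of_outcome _ hj).1)
        omega
    simp [hempty]

end SchoolChoice

theorem mainTheorem2 {I S : Type*} [Finite I] [Finite S]
    (hIS : Nat.card S < Nat.card I) (hS : 3 ≤ Nat.card S)
    (k l : ℕ) (hl : 1 ≤ l) (hlk : l < k) (hk : k ≤ Nat.card S) :
    SchoolChoice.MoreFairByStability
        ((SchoolChoice.GS (I := I) (S := S)).constrained k)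
        ((SchoolChoice.GS (I := I) (S := S)).constrained l) ∧
      ∃ p : SchoolChoice.Problem I S, (∀ s, 1 ≤ p.cap s) ∧
        SchoolChoice.IsStable p ((SchoolChoice.GS (I := I) (S := S)).constrained k p) ∧
        ¬ SchoolChoice.IsStable p ((SchoolChoice.GS (I := I) (S := S)).constrained l p) := by
  have hpos := SchoolChoice.isStable_constrained_commonProblem
    (Finite.equivFin S) (Finite.equivFin I) k
  have hneg := SchoolChoice.not_isStable_constrained_commonProblem
    (Finite.equivFin S) (Finite.equivFin I) hlk hk hIS
  exact ⟨⟨fun _ => SchoolChoice.isStable_constrained_of_le hlk.le, _, hpos, hneg⟩,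
    _, fun _ => le_rfl, hpos, hneg⟩
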